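/- All Banach spaces are real, $c_{00}$ is the space of finitely supported real sequences, a sequence $(x_i)$ is normalized if $\|x_i\|=1$ for all $i$, and $C(S)$ is the space of real continuous functions on $S$ with the supremum norm. Let $\delta\in(0,1]$. For a normalized, weakly null sequence $(x_i)$ in a Banach space let $K'((x_i),\delta)$ be the infimum of all real $C$ such that $$\Big\|\sum_{i\in E}a_ix_i\Big\|\le C\,\Big\|\sum_{i=1}^\infty a_ix_i\Big\|\qquad(*)$$ whenever $(a_i)\in c_{00}$, $\big\|\sum_i a_ix_i\big\|\le 1$ and $E\subset\{i\in\mathbb N:|a_i|\ge\delta\}$. Let $L'((x_i),\delta)$ be the infimum of all real $C$ such that $(*)$ holds whenever $(a_i)\in c_{00}$, $|a_i|\ge\delta$ for every $i$ with $a_i\ne0$, $\big\|\sum_i a_ix_i\big\|\le1$ and $E\subset\mathbb N$ is finite. Let $C(x_i)$ be the infimum of all real $C$ such that $(*)$ holds for all $(a_i)\in c_{00}$ and all finite $E\subset\mathbb N$. For a normalized, weakly null sequence $(f_i)$ in $C(S)$, with $S$ compact Hausdorff, let $K^*((f_i),\delta)$ be the infimum of all real $C$ such that $$\Big|\sum_{i\in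 E}a_if_i(t)\Big|\le C\,\Big\|\sum_{i=1}^\infty a_if_i\Big\|$$ for all $t\in S$, all $E\subset\{i\in\mathbb N:|f_i(t)|\ge\delta\}$ and all $(a_i)\in c_{00}$. (Here $\inf\emptyset=\infty$.) Put $$K'(\delta)=\sup_{(y_i)}\inf_{(z_i)\subset(y_i)}K'((z_i),\delta),\qquad L'(\delta)=\sup_{(y_i)}\inf_{(z_i)\subset(y_i)}L'((z_i),\delta),$$ $$K^*(\delta)=\sup_{S,(f_i)}\inf_{(g_i)\subset(f_i)}K^*((g_i),\delta),\qquad L^*(\delta)=\sup_{S,(f_i)}\inf_{(g_i)\subset(f_i)}C(g_i).$$ All infima are over subsequences. The suprema for $K',L'$ are over all normalized, weakly null sequences $(y_i)$ in Banach spaces. The supremum for $K^*$ is over all compact Hausdorff spaces $S$ and all normalized, weakly null sequences $(f_i)$ in $C(S)$. The supremum for $L^*$ is over those of them that satisfy $|f_i(t)|\in\{0\}\cup[\delta,1]$ for all $t\in S$ and $i\in\mathbb N$. Theorem. For all $0<\delta'<\delta\le1$, $$K^*(\delta)\le K'(\delta)\le K^*(\delta')\qquad\text{and}\qquad L^*(\delta)\le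 L'(\delta)\le L^*(\delta').$$ -/

import Mathlib

open Filter Topology

universe u v

noncomputable section

namespace PartialUnc

section Sequences

variable {X : Type u} [NormedAddCommGroup X] [NormedSpace ℝ X]

/-- `(x i)` is a normalized, weakly null sequence: every `x i` has norm `1`, and `φ (x i) → 0` for
every bounded linear functional `φ`. -/
structure NormalizedWeaklyNull (x : ℕ → X) : Prop where
  norm_eq_one : ∀ i, ‖x i‖ = 1
  weakly_null : ∀ φ : X →L[ℝ] ℝ, Tendsto (fun i => φ (x i)) atTop (𝓝 0)

/-- The vector `∑ i, a i • x i`, for a finitely supported sequence `a` of real numbers. -/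
def vec (x : ℕ → X) (a : ℕ →₀ ℝ) : X := a.sum fun i c => c • x i

/-- `K'((x i), δ)`: the infimum of the real numbers `C` such that
`‖∑ i ∈ E, a i • x i‖ ≤ C ‖∑ i, a i • x i‖` whenever `a` is finitely supported,
`‖∑ i, a i • x i‖ ≤ 1` and `E ⊆ {i | δ ≤ |a i|}` (such a set `E` is finite when `δ > 0`). -/
def kPrimeSeq (x : ℕ → X) (δ : ℝ) : EReal :=
  ⨅ (C : ℝ) (_ : ∀ (a : ℕ →₀ ℝ) (E : Finset ℕ), ‖vec x a‖ ≤ 1 → (∀ i ∈ E, δ ≤ |a i|) →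
    ‖∑ i ∈ E, a i • x i‖ ≤ C * ‖vec x a‖), (C : EReal)

/-- `L'((x i), δ)`: the infimum of the real numbers `C` such that
`‖∑ i ∈ E, a i • x i‖ ≤ C ‖∑ i, a i • x i‖` whenever `a` is finitely supported with all its
non-zero entries at least `δ` in absolute value, `‖∑ i, a i • x i‖ ≤ 1` and `E` is finite. -/
def lPrimeSeq (x : ℕ → X) (δ : ℝ) : EReal :=
  ⨅ (C : ℝ) (_ : ∀ (a : ℕ →₀ ℝ) (E : Finset ℕ), ‖vec x a‖ ≤ 1 → (∀ i ∈ a.support, δ ≤ |a i|) →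
    ‖∑ i ∈ E, a i • x i‖ ≤ C * ‖vec x a‖), (C : EReal)

/-- The unconditionality constant of `(x i)`: the infimum of the real numbers `C` such that
`‖∑ i ∈ E, a i • x i‖ ≤ C ‖∑ i, a i • x i‖` for all finitely supported `a` and all finite `E`.
For non-zero vectors such a `C` exists exactly if `(x i)` is an unconditional basic sequence;
otherwise the value is `⊤`. -/
def uncConst (x : ℕ → X) : EReal :=
  ⨅ (C : ℝ) (_ : ∀ (a : ℕ →₀ ℝ) (E : Finset ℕ),
    ‖∑ i ∈ E, a i • x i‖ ≤ C * ‖vec x a‖), (C : EReal)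

end Sequences

/-- `K*((f i), δ)`: the infimum of the real numbers `C` such that
`|∑ i ∈ E, a i * f i t| ≤ C ‖∑ i, a i • f i‖` for all finitely supported `a`, whenever `t` is a
point and `E ⊆ {i | δ ≤ |f i t|}` (such a set `E` is finite when `δ > 0` and `(f i)` is weakly
null). -/
def kStarSeq {S : Type u} [TopologicalSpace S] [CompactSpace S] (f : ℕ → C(S, ℝ)) (δ : ℝ) :
    EReal :=
  ⨅ (C : ℝ) (_ : ∀ (t : S) (E : Finset ℕ), (∀ i ∈ E, δ ≤ |f i t|) → ∀ a : ℕ →₀ ℝ,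
    |∑ i ∈ E, a i * f i t| ≤ C * ‖vec f a‖), (C : EReal)

/-- `K'(δ)`: the supremum of `inf K'((z i), δ)` over all normalized, weakly null sequences in real
Banach spaces, where the infimum is over all subsequences `(z i)` of the given one. -/
def kPrime (δ : ℝ) : EReal :=
  ⨆ (X : Type u) (_ : NormedAddCommGroup X) (_ : NormedSpace ℝ X) (_ : CompleteSpace X)
    (x : ℕ → X) (_ : NormalizedWeaklyNull x),
    ⨅ (n : ℕ → ℕ) (_ : StrictMono n), kPrimeSeq (x ∘ n) δ

/-- `L'(δ)`: the supremum of `inf L'((z i), δ)` over all normalized, weakly null sequences in real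
Banach spaces, where the infimum is over all subsequences `(z i)` of the given one. -/
def lPrime (δ : ℝ) : EReal :=
  ⨆ (X : Type u) (_ : NormedAddCommGroup X) (_ : NormedSpace ℝ X) (_ : CompleteSpace X)
    (x : ℕ → X) (_ : NormalizedWeaklyNull x),
    ⨅ (n : ℕ → ℕ) (_ : StrictMono n), lPrimeSeq (x ∘ n) δ

/-- `K*(δ)`: the supremum of `inf K*((g i), δ)` over all compact Hausdorff spaces `S` and all
normalized, weakly null sequences in `C(S)`, where the infimum is over all subsequences `(g i)` of
the given one. -/
def kStar (δ : ℝ) : EReal :=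
  ⨆ (S : Type u) (_ : TopologicalSpace S) (_ : CompactSpace S) (_ : T2Space S)
    (f : ℕ → C(S, ℝ)) (_ : NormalizedWeaklyNull f),
    ⨅ (n : ℕ → ℕ) (_ : StrictMono n), kStarSeq (f ∘ n) δ

/-- `L*(δ)`: the supremum of the infimum of the unconditionality constants of the subsequences of
`(f i)`, over all compact Hausdorff spaces `S` and all normalized, weakly null sequences `(f i)` in
`C(S)` with `|f i t| ∈ {0} ∪ [δ, 1]` for all `i` and `t`. -/
def lStar (δ : ℝ) : EReal :=
  ⨆ (S : Type u) (_ : TopologicalSpace S) (_ : CompactSpace S) (_ : T2Space S)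
    (f : ℕ → C(S, ℝ)) (_ : NormalizedWeaklyNull f)
    (_ : ∀ i t, |f i t| ∈ ({0} ∪ Set.Icc δ 1 : Set ℝ)),
    ⨅ (n : ℕ → ℕ) (_ : StrictMono n), uncConst (f ∘ n)

end PartialUnc

end

-- All four inequalities follow from one duality that exchanges coefficients and function values. In
-- the pairing `∑ a i * t (x i)` one may read `a` as coefficients and `t` as a point (an evaluation,
-- or a functional in the dual ball), or the numbers `t (x i)` as coefficients and `a` as a point of
-- a compact set of sequences. The threshold on coefficients in K', L' and the threshold on function
-- values in K*, L* then change places.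
--
-- Suppose that every subsequence of `x` violates the estimate with constant C₂. After scaling, each
-- violation is a pair `(a, t)` with `‖∑ a i • x i‖ = 1` and `|t (∑ i ∈ E, a i • x i)| > C₂`. Let
-- `K` be a compact set of sequences containing the unit vectors and, for every subsequence, some `a
-- / (1 + ε)` supported there, and let `y i` be the `i`-th coordinate on `K`. If `|∑ c i * t (x i)|
-- ≤ 1` for all `c` in `K`, then `∑ t (x i) • y i` has norm at most 1, while its part over `E`
-- exceeds `C₂ / (1 + ε)` at the point `a / (1 + ε)`. So every subsequence of `y` is bad too.
--
-- Two things are needed of `K`. Its members must have finite support, so that `y` is pointwise null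
-- and hence weakly null (`tendsto_of_pointwise`). And each chosen `t` must pair well with all of
-- `K`, also with coefficients chosen for other pairs. `exists_selection` ensures this: on a
-- subsequence, the functional attached to a minimal bad set nearly vanishes on all `x j` outside
-- that set. `exists_dual_compactum` builds `K` and `exists_dual_sequence` builds `y`.

universe w

noncomputable section

namespace PartialUnc

open scoped NNReal CompactlySupported

/-! ### Pointwise null implies weakly null in C(K), via the modulus of a functional. -/

section WeaklyNull

variable {K : Type u} [TopologicalSpace K]

/-- The values of a functional `φ` on the order interval `[-f, f]`. -/
def intervalValues (φ : C(K, ℝ) →L[ℝ] ℝ) (f : C(K, ℝ≥0)) : Set ℝ :=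
  {r | ∃ h : C(K, ℝ), (∀ x, |h x| ≤ f x) ∧ φ h = r}

theorem zero_mem_intervalValues (φ : C(K, ℝ) →L[ℝ] ℝ) (f : C(K, ℝ≥0)) :
    (0 : ℝ) ∈ intervalValues φ f :=
  ⟨0, by simp, by simp⟩

/-- The modulus of a functional on `C(K)`, on non-negative functions. -/
def modulus (φ : C(K, ℝ) →L[ℝ] ℝ) (f : C(K, ℝ≥0)) : ℝ := sSup (intervalValues φ f)

theorem modulus_le (φ : C(K, ℝ) →L[ℝ] ℝ) {f : C(K, ℝ≥0)} {r : ℝ}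
    (H : ∀ h : C(K, ℝ), (∀ x, |h x| ≤ f x) → φ h ≤ r) : modulus φ f ≤ r :=
  csSup_le ⟨0, zero_mem_intervalValues φ f⟩ fun _ ⟨h, hh, e⟩ => e ▸ H h hh

variable [CompactSpace K]

theorem bddAbove_intervalValues (φ : C(K, ℝ) →L[ℝ] ℝ) (f : C(K, ℝ≥0)) :
    BddAbove (intervalValues φ f) := by
  let F : C(K, ℝ) := ⟨fun x => f x, by fun_prop⟩
  refine ⟨‖φ‖ * ‖F‖, fun r ⟨h, hh, hr⟩ => ?_⟩
  rw [← hr]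
  refine (le_abs_self _).trans ((φ.le_opNorm h).trans ?_)
  refine mul_le_mul_of_nonneg_left ?_ (norm_nonneg _)
  refine (ContinuousMap.norm_le _ (norm_nonneg _)).2 fun x => (hh x).trans ?_
  exact (le_abs_self _).trans (ContinuousMap.norm_coe_le_norm F x)

theorem modulus_nonneg (φ : C(K, ℝ) →L[ℝ] ℝ) (f : C(K, ℝ≥0)) : 0 ≤ modulus φ f :=
  le_csSup (bddAbove_intervalValues φ f) (zero_mem_intervalValues φ f)

theorem le_modulus (φ : C(K, ℝ) →L[ℝ] ℝ) {f : C(K, ℝ≥0)} {h : C(K, ℝ)}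
    (hh : ∀ x, |h x| ≤ f x) : φ h ≤ modulus φ f :=
  le_csSup (bddAbove_intervalValues φ f) ⟨h, hh, rfl⟩

/-- Riesz decomposition: truncating `h` to `[-f₁, f₁]` leaves a remainder in `[-f₂, f₂]`. The other
inequality adds competitors. -/
theorem modulus_add (φ : C(K, ℝ) →L[ℝ] ℝ) (f₁ f₂ : C(K, ℝ≥0)) :
    modulus φ (f₁ + f₂) = modulus φ f₁ + modulus φ f₂ := by
  apply le_antisymm
  · refine modulus_le φ fun h hh => ?_
    let h₁ : C(K, ℝ) := ⟨fun x => max (-(f₁ x : ℝ)) (min (h x) (f₁ x)), by fun_prop⟩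
    have e : h = h₁ + (h - h₁) := by abel
    rw [e, map_add]
    refine add_le_add (le_modulus φ fun x => ?_) (le_modulus φ fun x => ?_)
    · have := NNReal.coe_nonneg (f₁ x)
      simp only [h₁, ContinuousMap.coe_mk, abs_le]
      grind
    · have h1 := NNReal.coe_nonneg (f₁ x)
      have h2 := NNReal.coe_nonneg (f₂ x)
      have h3 := hh x
      simp only [h₁, ContinuousMap.coe_mk, ContinuousMap.sub_apply, ContinuousMap.add_apply,
        NNReal.coe_add, abs_le] at *
      grind
  · rw [← le_sub_iff_add_le]
    refine modulus_le φ fun h₁ hh₁ => ?_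
    rw [le_sub_comm]
    refine modulus_le φ fun h₂ hh₂ => ?_
    rw [le_sub_iff_add_le, ← map_add]
    refine le_modulus φ fun x => ?_
    have := abs_add_le (h₂ x) (h₁ x)
    have h3 := hh₁ x
    have h4 := hh₂ x
    simp only [ContinuousMap.add_apply, NNReal.coe_add]
    linarith

theorem modulus_smul_le (φ : C(K, ℝ) →L[ℝ] ℝ) {c : ℝ≥0} (hc : c ≠ 0) (f : C(K, ℝ≥0)) :
    modulus φ (c • f) ≤ c * modulus φ f := by
  refine modulus_le φ fun h hh => ?_
  have hc' : (0 : ℝ) < c := by positivity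
  have e : h = (c : ℝ) • ((c : ℝ)⁻¹ • h) := by rw [smul_smul, mul_inv_cancel₀ hc'.ne', one_smul]
  rw [e, map_smul, smul_eq_mul]
  refine mul_le_mul_of_nonneg_left (le_modulus φ fun x => ?_) hc'.le
  have := hh x
  simp only [ContinuousMap.smul_apply, smul_eq_mul, NNReal.coe_mul, abs_mul, abs_inv,
    NNReal.abs_eq] at this ⊢
  rwa [inv_mul_le_iff₀ hc']

theorem modulus_smul (φ : C(K, ℝ) →L[ℝ] ℝ) (c : ℝ≥0) (f : C(K, ℝ≥0)) :
    modulus φ (c • f) = c * modulus φ f := by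
  rcases eq_or_ne c 0 with rfl | hc
  · have := modulus_add φ 0 0
    simp only [add_zero] at this
    simp only [zero_smul, NNReal.coe_zero, zero_mul]
    linarith
  · refine le_antisymm (modulus_smul_le φ hc f) ?_
    have := modulus_smul_le φ (inv_ne_zero hc) (c • f)
    rw [smul_smul, inv_mul_cancel₀ hc, one_smul, NNReal.coe_inv, ← div_eq_inv_mul,
      le_div_iff₀ (by positivity)] at this
    linarith

/-- The modulus of a functional on `C(K)`, as a positive functional. -/
def modulusLinear (φ : C(K, ℝ) →L[ℝ] ℝ) : C_c(K, ℝ≥0) →ₗ[ℝ≥0] ℝ≥0 where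
  toFun f := ⟨modulus φ f.toContinuousMap, modulus_nonneg φ _⟩
  map_add' f₁ f₂ := NNReal.eq (modulus_add φ f₁.toContinuousMap f₂.toContinuousMap)
  map_smul' c f := NNReal.eq (modulus_smul φ c f.toContinuousMap)

/-- A bounded sequence in `C(K)` that tends to zero pointwise is weakly null. -/
theorem tendsto_of_pointwise [T2Space K] {y : ℕ → C(K, ℝ)} (hb : ∀ i t, |y i t| ≤ 1)
    (hy : ∀ t, Tendsto (fun i => y i t) atTop (𝓝 0)) (φ : C(K, ℝ) →L[ℝ] ℝ) :
    Tendsto (fun i => φ (y i)) atTop (𝓝 0) := by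
  borelize K
  set μ := NNRealRMK.rieszMeasure (modulusLinear φ)
  let f : ℕ → C_c(K, ℝ≥0) := fun i => CompactlySupportedContinuousMap.continuousMapEquiv
    ⟨fun t => ‖y i t‖₊, by fun_prop⟩
  have hf : ∀ i t, ((f i t : ℝ≥0) : ℝ) = |y i t| := fun i t => rfl
  -- The Riesz measure of the modulus dominates `φ`, which reduces the claim to dominated
  -- convergence.
  have key : ∀ i, |φ (y i)| ≤ ∫ t, |y i t| ∂μ := fun i => by
    have h := NNRealRMK.integral_rieszMeasure (modulusLinear φ) (f i)
    simp only [hf] at h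
    rw [h]
    refine abs_le'.2 ⟨le_modulus φ fun x => (hf i x).ge, ?_⟩
    rw [← map_neg]
    refine le_modulus φ fun x => ?_
    rw [ContinuousMap.neg_apply, abs_neg]
    exact (hf i x).ge
  refine squeeze_zero_norm key ?_
  have : MeasureTheory.IsFiniteMeasure μ := inferInstance
  have := MeasureTheory.tendsto_integral_of_dominated_convergence (μ := μ)
    (F := fun i t => |y i t|) (f := fun _ => 0) (fun _ => 1)
    (fun i => (by fun_prop : Continuous fun t => |y i t|).aestronglyMeasurable)
    (MeasureTheory.integrable_const _) (fun i => .of_forall fun t => by simpa using hb i t)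
    (.of_forall fun t => by simpa using (hy t).abs)
  simpa using this

end WeaklyNull

/-! ### Selecting subsequences by ultrafilter limits along a well-founded tree of finite sets. -/

section Selection

/-- Construction of a sequence whose `k`-th term depends on the terms before it. -/
theorem exists_seq_of_history {Q : ℕ → (ℕ → ℕ) → ℕ → Prop}
    (hcongr : ∀ k h h' n, (∀ j < k, h j = h' j) → Q k h n → Q k h' n)
    (hex : ∀ k h, ∃ n, Q k h n) : ∃ ν : ℕ → ℕ, ∀ k, Q k ν (ν k) := by
  choose next hnext using hex
  let ν : ℕ → ℕ := fun k => Nat.strongRec (motive := fun _ => ℕ)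
    (fun k ih => next k fun j => if h : j < k then ih j h else 0) k
  have hν : ∀ k, ν k = next k fun j => if j < k then ν j else 0 := fun k => by
    simp only [ν]
    rw [Nat.strongRec_eq]
    simp
  refine ⟨ν, fun k => ?_⟩
  have h := hnext k fun j => if j < k then ν j else 0
  rw [← hν] at h
  exact hcongr k _ _ _ (fun j hj => by simp [hj]) h

variable {Bad : Finset ℕ → Prop}

/-- End-extension of sets without bad subsets is well-founded. -/
theorem wellFounded_endExtension (hmono : ∀ A B, A ⊆ B → Bad A → Bad B)
    (hex : ∀ n : ℕ → ℕ, StrictMono n → ∃ A : Finset ℕ, Bad A ∧ ∀ i ∈ A, i ∈ Set.range n) :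
    WellFounded fun B A : Finset ℕ => ¬ Bad A ∧ ∃ n, (∀ x ∈ A, x < n) ∧ B = insert n A := by
  -- An infinite chain adjoins the terms of a strictly increasing sequence. That sequence contains a
  -- finite bad set, which some member of the chain already includes.
  rw [wellFounded_iff_isEmpty_descending_chain]
  refine ⟨fun ⟨A, hA⟩ => ?_⟩
  choose hbad n hn hins using hA
  have hsub : ∀ k, n k ∈ A (k + 1) := fun k => by rw [hins]; exact Finset.mem_insert_self _ _
  have hm : Monotone A := monotone_nat_of_le_succ fun k => by
    rw [hins]; exact Finset.subset_insert _ _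
  have hmono' : StrictMono n := strictMono_nat_of_lt_succ fun k => hn (k + 1) _ (hsub k)
  obtain ⟨B, hB, hBn⟩ := hex n hmono'
  obtain ⟨k, hk⟩ : ∃ k, B ⊆ A k := by
    clear hB
    induction B using Finset.induction_on with
    | empty => exact ⟨0, by simp⟩
    | insert b B _ ih =>
      obtain ⟨k, hk⟩ := ih fun i hi => hBn i (Finset.mem_insert_of_mem hi)
      obtain ⟨l, rfl⟩ := hBn b (Finset.mem_insert_self _ _)
      refine ⟨max k (l + 1), Finset.insert_subset (hm (le_max_right _ _) (hsub l)) ?_⟩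
      exact hk.trans (hm (le_max_left _ _))
  exact hbad k (hmono _ _ hk hB)

variable {T : Type u} [TopologicalSpace T] [CompactSpace T] [Nonempty T]

/-- A map into a compact space that is given on the bad sets extends to all finite sets in such a
way that its value at a set that is not bad is the limit of the values at the one-point
end-extensions. -/
theorem exists_limit_extension (hmono : ∀ A B, A ⊆ B → Bad A → Bad B)
    (hex : ∀ n : ℕ → ℕ, StrictMono n → ∃ A : Finset ℕ, Bad A ∧ ∀ i ∈ A, i ∈ Set.range n)
    (φ : Finset ℕ → T) :
    ∃ s : Finset ℕ → T, (∀ A, Bad A → s A = φ A) ∧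
      ∀ A, ¬ Bad A → Tendsto (fun n => s (insert n A)) (hyperfilter ℕ) (𝓝 (s A)) := by
  classical
  have wf := wellFounded_endExtension hmono hex
  inhabit T
  -- Recursion from the bad sets down to `∅`. The default value is harmless: it is used only for `n`
  -- not above `A`, a null set for the nonprincipal ultrafilter.
  let step : ∀ A : Finset ℕ, (∀ B : Finset ℕ,
      (¬ Bad A ∧ ∃ n, (∀ x ∈ A, x < n) ∧ B = insert n A) → T) → T := fun A rec =>
    if h : Bad A then φ A else ((hyperfilter ℕ).map fun n =>
      if hn : ∀ x ∈ A, x < n then rec (insert n A) ⟨h, n, hn, rfl⟩ else default).lim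
  refine ⟨wf.fix step, fun A hA => ?_, fun A hA => ?_⟩
  · rw [wf.fix_eq]
    simp only [step, dif_pos hA]
  · rw [wf.fix_eq step A]
    simp only [step, dif_neg hA]
    set F := fun n : ℕ => if hn : ∀ x ∈ A, x < n then wf.fix step (insert n A) else default with hF
    have h1 : Tendsto F (hyperfilter ℕ) (𝓝 ((hyperfilter ℕ).map F).lim) :=
      ((hyperfilter ℕ).map F).le_nhds_lim
    refine h1.congr' ?_
    have h2 : ∀ᶠ n in (hyperfilter ℕ : Filter ℕ), ∀ x ∈ A, x < n := by
      refine Nat.hyperfilter_le_atTop ?_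
      rw [← Filter.Eventually, Filter.eventually_all_finset]
      exact fun x _ => eventually_gt_atTop x
    filter_upwards [h2] with n hn
    simp only [hF]
    rw [dif_pos hn]

/-- For pointwise null sequences `(g i)` of continuous functions: points `φ A` attached to the
bad sets `A` of integers, one can pass to a subsequence along which the `g j` with `j` outside
a minimal bad set `A` are small at `φ A`. -/
theorem exists_selection (hmono : ∀ A B, A ⊆ B → Bad A → Bad B)
    (hex : ∀ n : ℕ → ℕ, StrictMono n → ∃ A : Finset ℕ, Bad A ∧ ∀ i ∈ A, i ∈ Set.range n)
    (φ : Finset ℕ → T) {g : ℕ → T → ℝ} (hg : ∀ i, Continuous (g i))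
    (hnull : ∀ t, Tendsto (fun i => g i t) atTop (𝓝 0)) {ε : ℕ → ℝ} (hε : ∀ k, 0 < ε k) :
    ∃ ν : ℕ → ℕ, StrictMono ν ∧ ∀ F : Finset ℕ, Bad (F.image ν) →
      (∀ i ∈ F, ¬ Bad ((F.filter (· < i)).image ν)) →
      ∀ j ∉ F, |g (ν j) (φ (F.image ν))| < ε j := by
  classical
  obtain ⟨s, hs, hlim⟩ := exists_limit_extension hmono hex φ
  -- The new index `n` makes `g n` small at every `s A` with `A` among the earlier choices, and
  -- adjoining `n` to a set that is not bad preserves the smallness of earlier functions. Both hold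
  -- for ultrafilter-almost every `n`.
  obtain ⟨ν, hν⟩ := exists_seq_of_history (Q := fun k h n => (∀ j < k, h j < n) ∧
      ∀ A ∈ ((Finset.range k).image h).powerset, |g n (s A)| < ε k ∧ (¬ Bad A →
        ∀ j < k, |g (h j) (s A)| < ε j → |g (h j) (s (insert n A))| < ε j))
    (by
      intro k h h' n hh ⟨h1, h2⟩
      have e : (Finset.range k).image h' = (Finset.range k).image h :=
        Finset.image_congr fun j hj => (hh j (by simpa using hj)).symm
      refine ⟨fun j hj => hh j hj ▸ h1 j hj, fun A hA => ?_⟩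
      rw [e] at hA
      exact ⟨(h2 A hA).1, fun hb j hj => hh j hj ▸ (h2 A hA).2 hb j hj⟩)
    (by
      intro k h
      have hU := Nat.hyperfilter_le_atTop
      refine Eventually.exists (f := (hyperfilter ℕ : Filter ℕ)) (Eventually.and ?_ ?_)
      · refine hU ?_
        have := (Filter.eventually_all_finset (Finset.range k) (l := atTop)
          (p := fun j n => h j < n)).2 fun j _ => eventually_gt_atTop (h j)
        filter_upwards [this] with n hn j hj using hn j (Finset.mem_range.2 hj)
      · refine (Filter.eventually_all_finset _).2 fun A _ => Eventually.and ?_ ?_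
        · have := ((hnull (s A)).abs.mono_left hU).eventually_lt_const (u := ε k)
            (by simpa using hε k)
          exact this
        · by_cases hb : Bad A
          · exact .of_forall fun n hn => absurd hb hn
          · have := (Filter.eventually_all_finset (Finset.range k)
              (l := (hyperfilter ℕ : Filter ℕ))
              (p := fun j n => |g (h j) (s A)| < ε j → |g (h j) (s (insert n A))| < ε j)).2 (by
                intro j _
                by_cases hj : |g (h j) (s A)| < ε j
                · have h1 := ((hg (h j)).abs.tendsto (s A)).comp (hlim A hb)
                  filter_upwards [h1.eventually_lt_const hj] with n hn _ using hn
                · exact .of_forall fun n hn => absurd hn hj)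
            filter_upwards [this] with n hn _ j hj using hn j (Finset.mem_range.2 hj))
  have hstrict : StrictMono ν := strictMono_nat_of_lt_succ fun k => (hν (k + 1)).1 k (by simp)
  have hsmall : ∀ F : Finset ℕ, ∀ j, (∀ i ∈ F, i < j) → |g (ν j) (s (F.image ν))| < ε j :=
    fun F j hF => ((hν j).2 _ (Finset.mem_powerset.2 (Finset.image_subset_image
      fun i hi => Finset.mem_range.2 (hF i hi)))).1
  have key : ∀ F : Finset ℕ, (∀ i ∈ F, ¬ Bad ((F.filter (· < i)).image ν)) →
      ∀ j ∉ F, |g (ν j) (s (F.image ν))| < ε j := by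
    intro F
    induction F using Finset.induction_on_max with
    | empty => exact fun _ j _ => hsmall ∅ j (by simp)
    | insert a F ha ih =>
      intro hF j hj
      have e : ((insert a F).filter (· < a)) = F := by
        ext x
        simp only [Finset.mem_filter, Finset.mem_insert]
        refine ⟨fun ⟨h1, h2⟩ => h1.resolve_left h2.ne, fun h => ⟨.inr h, ha x h⟩⟩
      have hbad := hF a (Finset.mem_insert_self _ _)
      rw [e] at hbad
      have hja : j ≠ a := fun h => hj (h ▸ Finset.mem_insert_self _ _)
      have hjF : j ∉ F := fun h => hj (Finset.mem_insert_of_mem h)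
      rcases lt_or_gt_of_ne hja with hlt | hgt
      -- For `j < a`, smallness at `F` survives the adjunction of `a`. For `j > a`, it comes from
      -- the choice of `ν j`.
      · have h1 := ih (fun i hi hb => hbad (hmono _ _ (Finset.image_subset_image
          (Finset.filter_subset _ _)) hb)) j hjF
        rw [Finset.image_insert]
        exact ((hν a).2 _ (Finset.mem_powerset.2 (Finset.image_subset_image
          fun i hi => Finset.mem_range.2 (ha i hi)))).2 hbad j hlt h1
      · refine hsmall _ j fun i hi => ?_
        rcases Finset.mem_insert.1 hi with rfl | hi
        · exact hgt
        · exact (ha i hi).trans hgt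
  refine ⟨ν, hstrict, fun F hF hmin j hj => ?_⟩
  rw [← hs _ hF]
  exact key F hmin j hj

end Selection

theorem sum_geometric_le {η : ℝ} (hη : 0 ≤ η) (F : Finset ℕ) :
    ∑ k ∈ F, η / 2 / 2 ^ k ≤ η :=
  (Summable.sum_le_tsum F (fun _ _ => by positivity) (summable_geometric_two' η)).trans_eq
    (tsum_geometric_two' η)

theorem abs_sum_mul_le {η M : ℝ} (hη : 0 ≤ η) (hM : 0 ≤ M) {F : Finset ℕ} {a h : ℕ → ℝ}
    (ha : ∀ i ∈ F, |a i| ≤ M) (hh : ∀ i ∈ F, |h i| ≤ η / 2 / 2 ^ i) :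
    |∑ i ∈ F, a i * h i| ≤ M * η := by
  refine (Finset.abs_sum_le_sum_abs _ _).trans
    (le_trans ?_ (mul_le_mul_of_nonneg_left (sum_geometric_le hη F) hM))
  rw [Finset.mul_sum]
  refine Finset.sum_le_sum fun i hi => ?_
  rw [abs_mul]
  exact mul_le_mul (ha i hi) (hh i hi) (abs_nonneg _) hM

theorem vec_eq_sum {X : Type u} [NormedAddCommGroup X] [NormedSpace ℝ X] (x : ℕ → X)
    {a : ℕ →₀ ℝ} {F : Finset ℕ} (h : a.support ⊆ F) : vec x a = ∑ i ∈ F, a i • x i :=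
  Finsupp.sum_of_support_subset _ h _ fun _ _ => zero_smul _ _

/-! ### The weak-* dual ball and bounds for coordinate functionals. -/

section DualBall

variable (X : Type u) [NormedAddCommGroup X] [NormedSpace ℝ X]

/-- The unit ball of the dual space, with the weak-* topology. -/
abbrev DualBall : Type u :=
  ↥(WeakDual.toStrongDual ⁻¹' Metric.closedBall (0 : StrongDual ℝ X) 1 : Set (WeakDual ℝ X))

instance : CompactSpace (DualBall X) :=
  isCompact_iff_compactSpace.1 (WeakDual.isCompact_closedBall 0 1)

instance : Nonempty (DualBall X) := ⟨⟨0, by simp⟩⟩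

variable {X}

theorem DualBall.continuous_eval (v : X) : Continuous fun t : DualBall X => t.1 v :=
  (WeakDual.eval_continuous v).comp continuous_subtype_val

theorem DualBall.abs_apply_le (t : DualBall X) (v : X) : |t.1 v| ≤ ‖v‖ := by
  have h : ‖WeakDual.toStrongDual t.1‖ ≤ 1 := by
    simpa only [Set.mem_preimage, mem_closedBall_zero_iff] using t.2
  have := (WeakDual.toStrongDual t.1).le_of_opNorm_le h v
  simpa using this

theorem DualBall.exists_apply_eq (v : X) : ∃ t : DualBall X, t.1 v = ‖v‖ := by
  obtain ⟨φ, hφ, h⟩ := exists_dual_vector'' ℝ v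
  exact ⟨⟨StrongDual.toWeakDual φ, by simpa using hφ⟩, by simpa using h⟩

theorem DualBall.apply_vec (t : DualBall X) (x : ℕ → X) (a : ℕ →₀ ℝ) :
    t.1 (vec x a) = a.sum fun i c => c * t.1 (x i) := by
  simp [vec, Finsupp.sum, map_sum]

theorem NormalizedWeaklyNull.comp {x : ℕ → X} (hx : NormalizedWeaklyNull x) {ν : ℕ → ℕ}
    (hν : StrictMono ν) : NormalizedWeaklyNull (x ∘ ν) :=
  ⟨fun i => hx.1 (ν i), fun φ => (hx.2 φ).comp hν.tendsto_atTop⟩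

/-- A normalized weakly null sequence has a subsequence whose coordinate functionals have norm at
most `1 + ε`. -/
theorem NormalizedWeaklyNull.exists_coord_le {x : ℕ → X} (hx : NormalizedWeaklyNull x) {ε : ℝ}
    (hε : 0 < ε) : ∃ ν : ℕ → ℕ, StrictMono ν ∧
      ∀ (a : ℕ →₀ ℝ) i, |a i| ≤ (1 + ε) * ‖vec (x ∘ ν) a‖ := by
  classical
  choose t ht using fun i => DualBall.exists_apply_eq (x i)
  set η := ε / (1 + ε) with hη
  have hη0 : 0 < η := by positivity
  -- The minimal bad sets are now singletons, so the norming functional of each `x (ν i)` nearly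
  -- vanishes on the other terms. Testing it at the largest coefficient loses only the factor `1 - η
  -- = 1 / (1 + ε)`.
  obtain ⟨ν, hν, hsel⟩ := exists_selection (Bad := Finset.Nonempty) (T := DualBall X)
    (fun A B hAB hA => hA.mono hAB) (fun n _ => ⟨{n 0}, by simp, by simp⟩)
    (fun A => t (A.sup id)) (g := fun i t => t.1 (x i)) (fun i => DualBall.continuous_eval _)
    (fun t => hx.2 (WeakDual.toStrongDual t.1)) (ε := fun k => η / 2 / 2 ^ k)
    (fun k => by positivity)
  refine ⟨ν, hν, fun a i => ?_⟩
  have hsmall : ∀ i j, j ≠ i → |(t (ν i)).1 (x (ν j))| ≤ η / 2 / 2 ^ j := fun i j hj => by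
    have := hsel {i} (by simp) (by simp) j (by simpa using hj)
    simpa using this.le
  rcases eq_or_ne a 0 with rfl | ha
  · simp only [Finsupp.coe_zero, Pi.zero_apply, abs_zero]
    positivity
  obtain ⟨i₀, hi₀, hmax⟩ := a.support.exists_max_image (fun i => |a i|)
    (Finsupp.support_nonempty_iff.2 ha)
  have hmax' : ∀ j, |a j| ≤ |a i₀| := fun j => by
    by_cases hj : j ∈ a.support
    · exact hmax j hj
    · rw [Finsupp.notMem_support_iff.1 hj, abs_zero]; positivity
  refine (hmax' i).trans ?_
  have h1 : (t (ν i₀)).1 (vec (x ∘ ν) a) =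
      a i₀ + ∑ j ∈ a.support.erase i₀, a j * (t (ν i₀)).1 (x (ν j)) := by
    rw [DualBall.apply_vec, Finsupp.sum, ← Finset.add_sum_erase _ _ hi₀]
    simp [ht, hx.1]
  have h2 : |∑ j ∈ a.support.erase i₀, a j * (t (ν i₀)).1 (x (ν j))| ≤ |a i₀| * η := by
    exact abs_sum_mul_le hη0.le (abs_nonneg _) (fun j _ => hmax' j)
      fun j hj => hsmall i₀ j (Finset.ne_of_mem_erase hj)
  have h3 := DualBall.abs_apply_le (t (ν i₀)) (vec (x ∘ ν) a)
  have h4 : |a i₀| * (1 - η) ≤ ‖vec (x ∘ ν) a‖ := by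
    rw [h1] at h3
    have := abs_sub_abs_le_abs_sub (a i₀) (-∑ j ∈ a.support.erase i₀, a j * (t (ν i₀)).1 (x (ν j)))
    rw [sub_neg_eq_add, abs_neg] at this
    linarith
  have h5 : 1 - η = 1 / (1 + ε) := by rw [hη]; field_simp; ring
  rw [h5, mul_one_div, div_le_iff₀ (by positivity)] at h4
  linarith

end DualBall

/-! ### The compact set of coefficient sequences. -/

section DualCompactum

variable {T : Type u} [TopologicalSpace T] [CompactSpace T] [Nonempty T]

/-- The compact set of coefficient sequences behind the dual sequence: it contains the unit vectors
and, for every subsequence, the coefficients of a pair from `B` supported on that subsequence. -/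
theorem exists_dual_compactum {g : ℕ → T → ℝ} (hg : ∀ i, Continuous (g i))
    (hle : ∀ i t, |g i t| ≤ 1) (hnull : ∀ t, Tendsto (fun i => g i t) atTop (𝓝 0))
    {B : Set ((ℕ →₀ ℝ) × T)} {D : Set ℝ} (hD : IsClosed D) (h0 : (0 : ℝ) ∈ D) (h1 : (1 : ℝ) ∈ D)
    (hD1 : D ⊆ Set.Icc (-1) 1) {ε : ℝ} (hε : 0 < ε) (hB0 : ∀ p ∈ B, p.1 ≠ 0)
    (hB1 : ∀ p ∈ B, ∀ t, |p.1.sum fun i c => c * g i t| ≤ 1)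
    (hBD : ∀ p ∈ B, ∀ i, p.1 i / (1 + ε) ∈ D)
    (hex : ∀ n : ℕ → ℕ, StrictMono n → ∃ p ∈ B, ∀ i ∈ p.1.support, i ∈ Set.range n) :
    ∃ ν : ℕ → ℕ, StrictMono ν ∧ ∃ K : Set (ℕ → ℝ), IsCompact K ∧ (∀ c ∈ K, ∀ i, c i ∈ D) ∧
      (∀ c ∈ K, {i | c i ≠ 0}.Finite) ∧ (∀ i, Pi.single i 1 ∈ K) ∧
      ∀ m : ℕ → ℕ, StrictMono m → ∃ p ∈ B, ∃ k : ℕ,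
        p.1.support ⊆ (Finset.range k).image (ν ∘ m) ∧ (fun i => p.1 (ν i) / (1 + ε)) ∈ K ∧
        ∀ c ∈ K, |∑ l ∈ Finset.range k, c (m l) * g (ν (m l)) p.2| ≤ 1 := by
  classical
  let Bad : Finset ℕ → Prop := fun A => ∃ p ∈ B, p.1.support ⊆ A
  have hmono : ∀ A A', A ⊆ A' → Bad A → Bad A' := fun A A' h ⟨p, hp, hA⟩ => ⟨p, hp, hA.trans h⟩
  have hempty : ¬ Bad ∅ := fun ⟨p, hp, h⟩ => hB0 p hp (by simpa using h)
  have hexp : ∀ n : ℕ → ℕ, StrictMono n → ∃ A : Finset ℕ, Bad A ∧ ∀ i ∈ A, i ∈ Set.range n :=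
    fun n hn => let ⟨p, hp, h⟩ := hex n hn; ⟨_, ⟨p, hp, subset_rfl⟩, h⟩
  obtain ⟨p₀, hp₀, -⟩ := hex id strictMono_id
  -- The pair must depend on the set alone, so that the pairing conditions below can be imposed set
  -- by set.
  have : ∀ A, ∃ p ∈ B, Bad A → p.1.support ⊆ A := fun A => by
    by_cases h : Bad A
    · obtain ⟨p, hp, hA⟩ := h; exact ⟨p, hp, fun _ => hA⟩
    · exact ⟨p₀, hp₀, fun h' => absurd h' h⟩
  choose pick hpB hpA using this
  -- Coefficients are at most `1 + ε`, so total errors `η` cost `(1 + ε) * η = ε`. Dividing by `1 +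
  -- ε` brings the pairing `1 + ε` back to 1.
  set η := ε / (1 + ε) with hη
  have hη0 : 0 < η := by positivity
  obtain ⟨ν, hν, hsel⟩ := exists_selection hmono hexp (fun A => (pick A).2) hg hnull
    (ε := fun k => η / 2 / 2 ^ k) (fun k => by positivity)
  let Minimal : Finset ℕ → Prop := fun F => Bad (F.image ν) ∧
    ∀ i ∈ F, ¬ Bad ((F.filter (· < i)).image ν)
  -- The support may contain a bad set, but no point beyond it. This closed condition forces finite
  -- supports, and the extra point `i` leaves room for unit vectors and for sequences supported on
  -- minimal sets.
  let K₂ : Set (ℕ → ℝ) := {c | ∀ (G : Finset ℕ) (i : ℕ), (∀ x ∈ G, x < i) → Bad (G.image ν) →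
    ∃ j ∈ insert i G, c j = 0}
  let K₃ : Set (ℕ → ℝ) := {c | ∀ F : Finset ℕ, Minimal F →
    |∑ i ∈ F, c i * g (ν i) (pick (F.image ν)).2| ≤ 1}
  have hK₂ : IsClosed K₂ := by
    simp only [K₂, Set.ofPred_forall]
    refine isClosed_iInter fun G => isClosed_iInter fun i => isClosed_iInter fun _ =>
      isClosed_iInter fun _ => ?_
    have : {c : ℕ → ℝ | ∃ j ∈ insert i G, c j = 0} = ⋃ j ∈ insert i G, {c | c j = 0} := by
      ext; simp
    rw [this]
    exact Set.Finite.isClosed_biUnion (Finset.finite_toSet _)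
      fun j _ => isClosed_eq (continuous_apply j) continuous_const
  have hK₃ : IsClosed K₃ := by
    simp only [K₃, Set.ofPred_forall]
    exact isClosed_iInter fun F => isClosed_iInter fun _ =>
      isClosed_le (by fun_prop) continuous_const
  have hDc : IsCompact D := isCompact_Icc.of_isClosed_subset hD hD1
  refine ⟨ν, hν, Set.univ.pi (fun _ => D) ∩ (K₂ ∩ K₃),
    (isCompact_univ_pi fun _ => hDc).inter_right (hK₂.inter hK₃), ?_, ?_, ?_, ?_⟩
  · exact fun c hc i => hc.1 i (Set.mem_univ i)
  · rintro c ⟨-, hc, -⟩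
    by_contra hinf
    have hinf : {i | c i ≠ 0}.Infinite := hinf
    have hm := Nat.nth_strictMono hinf
    obtain ⟨A, hA, hAr⟩ := hexp (ν ∘ Nat.nth fun i => c i ≠ 0) (hν.comp hm)
    let G := A.preimage ν hν.injective.injOn
    have hG : ∀ i ∈ G, c i ≠ 0 := fun i hi => by
      obtain ⟨l, hl⟩ := hAr (ν i) (Finset.mem_preimage.1 hi)
      rw [← hν.injective hl]
      exact Nat.nth_mem_of_infinite hinf l
    have hAG : A ⊆ G.image ν := fun a ha => by
      obtain ⟨l, rfl⟩ := hAr a ha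
      exact Finset.mem_image.2 ⟨_, Finset.mem_preimage.2 ha, rfl⟩
    obtain ⟨i, hi, hgt⟩ := hinf.exists_gt (G.sup id)
    obtain ⟨j, hj, hj0⟩ := hc G i (fun x hx => (Finset.le_sup (f := id) hx).trans_lt hgt)
      (hmono _ _ hAG hA)
    rcases Finset.mem_insert.1 hj with rfl | hj
    · exact hi hj0
    · exact hG j hj hj0
  · refine fun i => ⟨fun j _ => ?_, fun G i' hG hbad => ?_, fun F _ => ?_⟩
    · rcases eq_or_ne j i with rfl | h
      · simpa using h1
      · simpa [Pi.single_eq_of_ne h] using h0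
    · obtain ⟨x, hx⟩ : G.Nonempty := by
        by_contra h
        rw [Finset.not_nonempty_iff_eq_empty.1 h] at hbad
        exact hempty (by simpa using hbad)
      rcases eq_or_ne x i with rfl | h
      · exact ⟨i', Finset.mem_insert_self _ _, Pi.single_eq_of_ne (hG x hx).ne' _⟩
      · exact ⟨x, Finset.mem_insert_of_mem hx, Pi.single_eq_of_ne h _⟩
    · by_cases hi : i ∈ F
      · rw [Finset.sum_eq_single_of_mem i hi fun j _ hj => by simp [Pi.single_eq_of_ne hj]]
        simpa using hle _ _
      · rw [Finset.sum_eq_zero fun j hj => by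
          rw [Pi.single_eq_of_ne (fun h : j = i => hi (h ▸ hj)), zero_mul]]
        simp
  · intro m hm
    have hexk : ∃ k, Bad ((Finset.range k).image (ν ∘ m)) := by
      obtain ⟨A, hA, hAr⟩ := hexp (ν ∘ m) (hν.comp hm)
      let G := A.preimage (ν ∘ m) (hν.comp hm).injective.injOn
      refine ⟨G.sup id + 1, hmono A _ (fun a ha => ?_) hA⟩
      obtain ⟨l, rfl⟩ := hAr a ha
      refine Finset.mem_image.2 ⟨l, Finset.mem_range.2 (Nat.lt_succ_of_le ?_), rfl⟩
      exact Finset.le_sup (f := id) (Finset.mem_preimage.2 ha)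
    -- The shortest bad initial segment of the subsequence is a minimal set.
    let k := Nat.find hexk
    have hk : Bad ((Finset.range k).image (ν ∘ m)) := Nat.find_spec hexk
    let G := (Finset.range k).image m
    have eG : (Finset.range k).image (ν ∘ m) = G.image ν := Finset.image_image.symm
    have hG : Minimal G := by
      refine ⟨eG ▸ hk, fun i hi hbad => ?_⟩
      obtain ⟨l, hl, rfl⟩ := Finset.mem_image.1 hi
      refine Nat.find_min hexk (Finset.mem_range.1 hl) (hmono _ _ (fun z hz => ?_) hbad)
      obtain ⟨z', hz', rfl⟩ := Finset.mem_image.1 hz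
      obtain ⟨hz1, hz2⟩ := Finset.mem_filter.1 hz'
      obtain ⟨q, -, rfl⟩ := Finset.mem_image.1 hz1
      exact Finset.mem_image.2 ⟨q, Finset.mem_range.2 (hm.lt_iff_lt.1 hz2), rfl⟩
    set p := pick (G.image ν) with hp
    have hsupp : p.1.support ⊆ G.image ν := hpA _ hG.1
    have hzero : ∀ i ∉ G, p.1 (ν i) = 0 := fun i hi => by
      by_contra h
      obtain ⟨j, hj, e⟩ := Finset.mem_image.1 (hsupp (Finsupp.mem_support_iff.2 h))
      exact hi (hν.injective e ▸ hj)
    have hbound : ∀ i, |p.1 i| ≤ 1 + ε := fun i => by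
      have := abs_le.2 (hD1 (hBD p (hpB _) i))
      rwa [abs_div, abs_of_pos (by positivity : 0 < 1 + ε), div_le_one (by positivity)] at this
    refine ⟨p, hpB _, k, eG ▸ hsupp, ⟨fun i _ => hBD p (hpB _) _, fun G' i hG' hbad => ?_,
      fun F hF => ?_⟩, fun c hc => ?_⟩
    · by_contra! hne
      have hin : ∀ j ∈ insert i G', j ∈ G := fun j hj => by
        by_contra h
        exact hne j hj (by rw [hzero j h, zero_div])
      refine hG.2 i (hin i (Finset.mem_insert_self _ _)) (hmono _ _
        (Finset.image_subset_image fun j hj => ?_) hbad)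
      exact Finset.mem_filter.2 ⟨hin j (Finset.mem_insert_of_mem hj), hG' j hj⟩
    · set t := (pick (F.image ν)).2
      have e1 : ∑ i ∈ G, p.1 (ν i) * g (ν i) t = p.1.sum fun i c => c * g i t := by
        rw [Finsupp.sum_of_support_subset _ hsupp _ (by simp),
          Finset.sum_image hν.injective.injOn]
      -- The coefficients live on `G` but the functional belongs to `F`: the full sum over `G` is at
      -- most 1 by the norm bound, and the part off `F` is small by selection.
      have e2 : ∑ i ∈ F, p.1 (ν i) * g (ν i) t =
          ∑ i ∈ G, p.1 (ν i) * g (ν i) t - ∑ i ∈ G \ F, p.1 (ν i) * g (ν i) t := by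
        rw [eq_sub_iff_add_eq, ← Finset.sum_union Finset.disjoint_sdiff]
        refine (Finset.sum_subset (fun i hi => ?_) fun i _ hi => ?_).symm
        · by_cases h : i ∈ F <;> simp [h, hi]
        · rw [hzero i hi, zero_mul]
      have e3 : |∑ i ∈ G \ F, p.1 (ν i) * g (ν i) t| ≤ (1 + ε) * η := by
        exact abs_sum_mul_le hη0.le (by positivity) (fun i _ => hbound _)
          fun i hi => (hsel F hF.1 hF.2 i (Finset.mem_sdiff.1 hi).2).le
      have e4 : (1 + ε) * η = ε := by rw [hη]; field_simp
      have e5 := hB1 p (hpB _) t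
      rw [← e1] at e5
      simp only [div_mul_eq_mul_div, ← Finset.sum_div]
      rw [abs_div, abs_of_pos (by positivity : 0 < 1 + ε), div_le_one (by positivity), e2]
      refine (abs_sub _ _).trans ?_
      linarith
    · have := hc.2.2 G hG
      rw [Finset.sum_image hm.injective.injOn] at this
      exact this

end DualCompactum

/-! ### The coordinate functions as a dual sequence. -/

section DualSequence

variable {X : Type v} [NormedAddCommGroup X] [NormedSpace ℝ X]

theorem map_vec (ψ : X →L[ℝ] ℝ) (x : ℕ → X) (a : ℕ →₀ ℝ) :
    ψ (vec x a) = a.sum fun i c => c * ψ (x i) := by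
  simp [vec, Finsupp.sum, map_sum]

theorem vec_single (x : ℕ → X) (i : ℕ) (c : ℝ) : vec x (Finsupp.single i c) = c • x i :=
  Finsupp.sum_single_index (zero_smul _ _)

/-- A combination of a subsequence, scaled to norm one and regarded as a combination of the whole
sequence. -/
theorem exists_normalized_extension {x : ℕ → X} {M : ℝ}
    (hcoord : ∀ (a : ℕ →₀ ℝ) i, |a i| ≤ M * ‖vec x a‖) {n : ℕ → ℕ} (hn : StrictMono n)
    {a : ℕ →₀ ℝ} {E : Finset ℕ} {ψ : X →L[ℝ] ℝ} {C : ℝ}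
    (h : C * ‖vec (x ∘ n) a‖ < |ψ (∑ k ∈ E, a k • x (n k))|) :
    ∃ (r : ℝ) (a' : ℕ →₀ ℝ) (E' : Finset ℕ), 0 < r ∧ r * ‖vec (x ∘ n) a‖ = 1 ∧ ‖vec x a'‖ = 1 ∧
      (∀ k, a' (n k) = r * a k) ∧ (∀ i ∈ a'.support, ∃ k ∈ a.support, n k = i) ∧
      (∀ i ∈ E', ∃ k ∈ E, n k = i) ∧ C < |ψ (∑ i ∈ E', a' i • x i)| := by
  classical
  let e : ℕ ↪ ℕ := ⟨n, hn.injective⟩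
  have hvec : vec x (a.embDomain e) = vec (x ∘ n) a := by
    simp only [vec, Finsupp.sum_embDomain]
    rfl
  have happ : ∀ k, a.embDomain e (n k) = a k := fun k => Finsupp.embDomain_apply_self e a k
  have hpos : 0 < ‖vec (x ∘ n) a‖ := by
    rw [norm_pos_iff]
    -- The coordinate bound gives linear independence: a zero combination has zero coefficients,
    -- which contradicts the strict inequality.
    intro h0
    have ha : a = 0 := by
      ext k
      have := hcoord (a.embDomain e) (n k)
      rw [happ, hvec, h0, norm_zero, mul_zero] at this
      simpa using this
    simp [ha, vec] at h
  set N := ‖vec (x ∘ n) a‖ with hN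
  have hvec' : vec x (N⁻¹ • a.embDomain e) = N⁻¹ • vec (x ∘ n) a := by
    rw [← hvec, vec, vec, Finsupp.sum_smul_index (by simp), Finsupp.smul_sum]
    simp [mul_smul]
  refine ⟨N⁻¹, N⁻¹ • a.embDomain e, E.map e, by positivity, inv_mul_cancel₀ hpos.ne', ?_,
    fun k => by simp [happ], fun i hi => ?_, fun i hi => by simpa [e] using hi, ?_⟩
  · rw [hvec', norm_smul, norm_inv, Real.norm_of_nonneg hpos.le, ← hN, inv_mul_cancel₀ hpos.ne']
  · have h1 := Finsupp.support_smul hi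
    rw [Finsupp.support_embDomain] at h1
    simpa [e] using h1
  · have : ∑ i ∈ E.map e, (N⁻¹ • a.embDomain e) i • x i = N⁻¹ • ∑ k ∈ E, a k • x (n k) := by
      rw [Finset.sum_map, Finset.smul_sum]
      refine Finset.sum_congr rfl fun k _ => ?_
      simp only [e, Function.Embedding.coeFn_mk, Finsupp.smul_apply, smul_eq_mul, mul_smul]
      rw [← happ k]
    rw [this, map_smul, smul_eq_mul, abs_mul, abs_of_pos (by positivity : 0 < N⁻¹),
      ← div_eq_inv_mul, lt_div_iff₀ hpos]
    exact h

variable {T : Type u} [TopologicalSpace T] [CompactSpace T] [Nonempty T]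

/-- The dual sequence: coordinate functions on a compact space of coefficient sequences, such that
functionals `ev t` on the given sequence become vectors of norm at most `1` and the coefficients,
divided by `1 + ε`, become points. -/
theorem exists_dual_sequence {x : ℕ → X} (hx : NormalizedWeaklyNull x) {ev : T → X →L[ℝ] ℝ}
    (hev : ∀ t v, |ev t v| ≤ ‖v‖) (hcont : ∀ i, Continuous fun t => ev t (x i)) {ε : ℝ}
    (hε : 0 < ε) (hcoord : ∀ (a : ℕ →₀ ℝ) i, |a i| ≤ (1 + ε) * ‖vec x a‖)
    {B : Set ((ℕ →₀ ℝ) × T)} {D : Set ℝ} (hD : IsClosed D) (h0 : (0 : ℝ) ∈ D) (h1 : (1 : ℝ) ∈ D)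
    (hD1 : D ⊆ Set.Icc (-1) 1) (hB : ∀ p ∈ B, ‖vec x p.1‖ = 1)
    (hBD : ∀ p ∈ B, ∀ i, |p.1 i / (1 + ε)| ≤ 1 → p.1 i / (1 + ε) ∈ D)
    (hex : ∀ n : ℕ → ℕ, StrictMono n → ∃ p ∈ B, ∀ i ∈ p.1.support, i ∈ Set.range n) :
    ∃ (S : Type w) (_ : TopologicalSpace S) (_ : CompactSpace S) (_ : T2Space S)
      (y : ℕ → C(S, ℝ)), NormalizedWeaklyNull y ∧ (∀ i c, y i c ∈ D) ∧
      ∀ m : ℕ → ℕ, StrictMono m → ∃ p ∈ B, ∃ (n : ℕ → ℕ) (c : S) (b : ℕ →₀ ℝ),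
        ‖vec (y ∘ m) b‖ ≤ 1 ∧ (∀ k, y (m k) c = p.1 (n k) / (1 + ε)) ∧
        (∀ k, b k = 0 ∨ b k = ev p.2 (x (n k))) ∧
        ∀ E : Finset ℕ, ∃ E' : Finset ℕ, (∀ k ∈ E', n k ∈ E ∧ b k = ev p.2 (x (n k))) ∧
          ∑ k ∈ E', b k * y (m k) c = ev p.2 (∑ i ∈ E, p.1 i • x i) / (1 + ε) := by
  classical
  obtain ⟨ν, hν, K, hK, hKD, hfin, hsingle, hdual⟩ := exists_dual_compactum
    (g := fun i t => ev t (x i)) hcont (fun i t => (hev t _).trans_eq (hx.1 i))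
    (fun t => hx.2 (ev t)) hD h0 h1 hD1 hε (B := B)
    (fun p hp h => by have := hB p hp; simp [h, vec] at this)
    (fun p hp t => by rw [← map_vec]; exact (hev t _).trans_eq (hB p hp))
    (fun p hp i => hBD p hp i (by
      have := hcoord p.1 i
      rw [hB p hp, mul_one] at this
      rwa [abs_div, abs_of_pos (by positivity : 0 < 1 + ε), div_le_one (by positivity)])) hex
  have : CompactSpace K := isCompact_iff_compactSpace.1 hK
  -- Lifting `K` lets the dual space live in any universe.
  let y : ℕ → C(ULift.{w} K, ℝ) := fun i => ⟨fun c => c.down.1 i,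
    (continuous_apply i).comp (continuous_subtype_val.comp continuous_uliftDown)⟩
  have hy1 : ∀ i c, |y i c| ≤ 1 := fun i c => abs_le.2 (hD1 (hKD _ c.down.2 i))
  refine ⟨ULift.{w} K, inferInstance, inferInstance, inferInstance, y, ⟨fun i => ?_, fun φ =>
    tendsto_of_pointwise hy1 (fun c => ?_) φ⟩, fun i c => hKD _ c.down.2 i, fun m hm => ?_⟩
  · refine le_antisymm ((ContinuousMap.norm_le _ zero_le_one).2 (hy1 i)) ?_
    have := (y i).norm_coe_le_norm ⟨⟨Pi.single i 1, hsingle i⟩⟩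
    simpa [y] using this
  · refine tendsto_const_nhds.congr' ?_
    have := (hfin _ c.down.2).bddAbove
    obtain ⟨M, hM⟩ := this
    filter_upwards [eventually_gt_atTop M] with i hi
    by_contra h
    exact absurd (hM (show i ∈ _ from fun h' => h h'.symm)) (not_le.2 hi)
  · obtain ⟨p, hp, k, hsupp, hpK, hle⟩ := hdual m hm
    let n := ν ∘ m
    have hn : n.Injective := (hν.comp hm).injective
    let c : ULift.{w} K := ⟨⟨_, hpK⟩⟩
    -- Old function values become new coefficients, cut off at the bad initial segment, where the
    -- bound on `K` applies.
    let b : ℕ →₀ ℝ := Finsupp.indicator (Finset.range k) fun l _ => ev p.2 (x (n l))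
    have hb : ∀ l ∈ Finset.range k, b l = ev p.2 (x (n l)) := fun l hl =>
      Finsupp.indicator_of_mem hl _
    refine ⟨p, hp, n, c, b, ?_, fun l => rfl, fun l => ?_, fun E =>
      ⟨(Finset.range k).filter fun l => n l ∈ E, fun l hl => ?_, ?_⟩⟩
    · rw [vec_eq_sum (F := Finset.range k) _ (Finsupp.support_indicator_subset _ _),
        ContinuousMap.norm_le _ zero_le_one]
      intro z
      rw [ContinuousMap.sum_apply]
      refine le_of_eq_of_le ?_ (hle _ z.down.2)
      rw [Real.norm_eq_abs]
      congr 1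
      refine Finset.sum_congr rfl fun l hl => ?_
      rw [hb l hl]
      exact mul_comm _ _
    · by_cases hl : l ∈ Finset.range k
      · exact .inr (hb l hl)
      · exact .inl (Finsupp.indicator_of_notMem hl _)
    · obtain ⟨hl, hlE⟩ := Finset.mem_filter.1 hl
      exact ⟨hlE, hb l hl⟩
    · have e1 : ev p.2 (∑ i ∈ E, p.1 i • x i) =
          ∑ i ∈ ((Finset.range k).filter fun l => n l ∈ E).image n, p.1 i * ev p.2 (x i) := by
        simp only [map_sum, map_smul, smul_eq_mul]
        refine (Finset.sum_subset (fun i hi => ?_) fun i hi hni => ?_).symm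
        · obtain ⟨l, hl, rfl⟩ := Finset.mem_image.1 hi
          exact (Finset.mem_filter.1 hl).2
        · by_contra hne
          have hi' : i ∈ p.1.support := Finsupp.mem_support_iff.2 fun h => hne (by simp [h])
          obtain ⟨l, hl, rfl⟩ := Finset.mem_image.1 (hsupp hi')
          exact hni (Finset.mem_image_of_mem _ (Finset.mem_filter.2 ⟨hl, hi⟩))
      rw [e1, Finset.sum_image hn.injOn, Finset.sum_div]
      refine Finset.sum_congr rfl fun l hl => ?_
      rw [hb l (Finset.mem_filter.1 hl).1]
      change _ * (p.1 (n l) / (1 + ε)) = _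
      ring

end DualSequence

/-! ### Unpacking suprema and infima; the choice of ε. -/

section Infima

theorem exists_lt_of_iInf_lt {P : ℝ → Prop} {c : EReal}
    (h : ⨅ (C : ℝ) (_ : P C), (C : EReal) < c) : ∃ C : ℝ, P C ∧ (C : EReal) < c := by
  simpa [iInf_lt_iff] using h

theorem not_of_lt_iInf {P : ℝ → Prop} {C : ℝ} (h : (C : EReal) < ⨅ (C : ℝ) (_ : P C), (C : EReal)) :
    ¬ P C :=
  fun hC => (iInf₂_le (f := fun (C : ℝ) (_ : P C) => (C : EReal)) C hC).not_gt h

theorem lt_seq_of_lt_iInf {F : (ℕ → ℕ) → EReal} {c : EReal}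
    (h : c < ⨅ (n : ℕ → ℕ) (_ : StrictMono n), F n) {n : ℕ → ℕ} (hn : StrictMono n) : c < F n :=
  h.trans_le (iInf₂_le n hn)

theorem exists_pos_mul_one_add_lt {a b c d : ℝ} (h : a < b) (h' : c < d) :
    ∃ ε : ℝ, 0 < ε ∧ a * (1 + ε) < b ∧ c * (1 + ε) < d := by
  have key : ∀ {p q : ℝ}, p < q → ∀ᶠ ε in 𝓝[>] (0 : ℝ), p * (1 + ε) < q := fun {p q} hpq => by
    have : Tendsto (fun ε : ℝ => p * (1 + ε)) (𝓝 0) (𝓝 (p * (1 + 0))) :=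
      (by fun_prop : Continuous fun ε : ℝ => p * (1 + ε)).tendsto 0
    exact (this.mono_left nhdsWithin_le_nhds).eventually_lt_const (by simpa using hpq)
  obtain ⟨ε, ⟨h1, h2⟩, h3⟩ := ((key h).and (key h')).and self_mem_nhdsWithin |>.exists
  exact ⟨ε, h3, h1, h2⟩

theorem exists_lt_of_kPrime_lt {δ : ℝ} {c : EReal} (h : kPrime.{v} δ < c) {X : Type v}
    [i₁ : NormedAddCommGroup X] [i₂ : NormedSpace ℝ X] [i₃ : CompleteSpace X] {x : ℕ → X}
    (hx : NormalizedWeaklyNull x) : ∃ m : ℕ → ℕ, StrictMono m ∧ kPrimeSeq (x ∘ m) δ < c := by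
  have : ⨅ (n : ℕ → ℕ) (_ : StrictMono n), kPrimeSeq (x ∘ n) δ < c := lt_of_le_of_lt (by
    refine le_iSup_of_le X <| le_iSup_of_le i₁ <| le_iSup_of_le i₂ <| le_iSup_of_le i₃ <| ?_
    exact le_iSup_of_le x <| le_iSup_of_le hx le_rfl) h
  simpa [iInf_lt_iff] using this

theorem exists_lt_of_lPrime_lt {δ : ℝ} {c : EReal} (h : lPrime.{v} δ < c) {X : Type v}
    [i₁ : NormedAddCommGroup X] [i₂ : NormedSpace ℝ X] [i₃ : CompleteSpace X] {x : ℕ → X}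
    (hx : NormalizedWeaklyNull x) : ∃ m : ℕ → ℕ, StrictMono m ∧ lPrimeSeq (x ∘ m) δ < c := by
  have : ⨅ (n : ℕ → ℕ) (_ : StrictMono n), lPrimeSeq (x ∘ n) δ < c := lt_of_le_of_lt (by
    refine le_iSup_of_le X <| le_iSup_of_le i₁ <| le_iSup_of_le i₂ <| le_iSup_of_le i₃ <| ?_
    exact le_iSup_of_le x <| le_iSup_of_le hx le_rfl) h
  simpa [iInf_lt_iff] using this

theorem exists_lt_of_kStar_lt {δ : ℝ} {c : EReal} (h : kStar.{u} δ < c) {S : Type u}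
    [i₁ : TopologicalSpace S] [i₂ : CompactSpace S] [i₃ : T2Space S] {f : ℕ → C(S, ℝ)}
    (hf : NormalizedWeaklyNull f) : ∃ m : ℕ → ℕ, StrictMono m ∧ kStarSeq (f ∘ m) δ < c := by
  have : ⨅ (n : ℕ → ℕ) (_ : StrictMono n), kStarSeq (f ∘ n) δ < c := lt_of_le_of_lt (by
    refine le_iSup_of_le S <| le_iSup_of_le i₁ <| le_iSup_of_le i₂ <| le_iSup_of_le i₃ <| ?_
    exact le_iSup_of_le f <| le_iSup_of_le hf le_rfl) h
  simpa [iInf_lt_iff] using this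

theorem exists_lt_of_lStar_lt {δ : ℝ} {c : EReal} (h : lStar.{u} δ < c) {S : Type u}
    [i₁ : TopologicalSpace S] [i₂ : CompactSpace S] [i₃ : T2Space S] {f : ℕ → C(S, ℝ)}
    (hf : NormalizedWeaklyNull f) (hfδ : ∀ i t, |f i t| ∈ ({0} ∪ Set.Icc δ 1 : Set ℝ)) :
    ∃ m : ℕ → ℕ, StrictMono m ∧ uncConst (f ∘ m) < c := by
  have : ⨅ (n : ℕ → ℕ) (_ : StrictMono n), uncConst (f ∘ n) < c := lt_of_le_of_lt (by
    refine le_iSup_of_le S <| le_iSup_of_le i₁ <| le_iSup_of_le i₂ <| le_iSup_of_le i₃ <| ?_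
    exact le_iSup_of_le f <| le_iSup_of_le hf <| le_iSup_of_le hfδ le_rfl) h
  simpa [iInf_lt_iff] using this

end Infima

/-! ### The four inequalities. -/

section Inequalities

theorem NormalizedWeaklyNull.nonempty {S : Type u} [TopologicalSpace S] [CompactSpace S]
    {f : ℕ → C(S, ℝ)} (hf : NormalizedWeaklyNull f) : Nonempty S := by
  by_contra h
  rw [not_nonempty_iff] at h
  have h1 := hf.1 0
  rw [Subsingleton.elim (f 0) 0, norm_zero] at h1
  exact zero_ne_one h1

theorem exists_abs_apply_eq_norm {S : Type u} [TopologicalSpace S] [CompactSpace S] [Nonempty S]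
    (v : C(S, ℝ)) : ∃ t, |v t| = ‖v‖ := by
  obtain ⟨t, -, ht⟩ := isCompact_univ.exists_isMaxOn (f := fun t => |v t|) Set.univ_nonempty
    (by fun_prop)
  refine ⟨t, le_antisymm (v.norm_coe_le_norm t) ?_⟩
  exact (ContinuousMap.norm_le _ (abs_nonneg _)).2 fun s => ht (Set.mem_univ s)

/-- Scaling a vector of norm at most 1 up to norm 1 cannot push coefficients below the threshold.
This is where the normalization in K' and L' enters. -/
theorem abs_le_abs_of_eq_mul {r N a a' : ℝ} (hr : 0 < r) (hN : N ≤ 1) (hrN : r * N = 1)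
    (h : a' = r * a) : |a| ≤ |a'| := by
  rw [h, abs_mul, abs_of_pos hr]
  refine le_mul_of_one_le_left (abs_nonneg a) ?_
  nlinarith

theorem false_of_bounds {ε C C₁ C₂ N V s : ℝ} (hε : 0 < ε) (hN : N ≤ 1) (hC : 1 ≤ C) (hCC : C < C₁)
    (hCε : C₁ * (1 + ε) < C₂) (hV : C₂ < |V|) (hs : s = V / (1 + ε)) (h : |s| ≤ C * N) : False := by
  rw [hs, abs_div, abs_of_pos (by positivity : 0 < 1 + ε), div_le_iff₀ (by positivity)] at h
  have h4 : C * N ≤ C₁ := (mul_le_of_le_one_right (by linarith) hN).trans hCC.le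
  have h5 := mul_le_mul_of_nonneg_right h4 (by positivity : 0 ≤ 1 + ε)
  linarith

theorem kStar_le_kPrime {δ : ℝ} (hδ : δ ≤ 1) : kStar.{u} δ ≤ kPrime.{v} δ := by
  refine iSup_le fun S => iSup_le fun _ => iSup_le fun _ => iSup_le fun _ => iSup_le fun f =>
    iSup_le fun hf => ?_
  by_contra! h
  obtain ⟨C₁, hC₁, h⟩ := EReal.lt_iff_exists_real_btwn.1 h
  obtain ⟨C₂, hC, hC₂⟩ := EReal.lt_iff_exists_real_btwn.1 h
  obtain ⟨ε, hε, hCε, -⟩ := exists_pos_mul_one_add_lt (EReal.coe_lt_coe_iff.1 hC) zero_lt_one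
  obtain ⟨ν, hν, hcoord⟩ := hf.exists_coord_le hε
  have := hf.nonempty
  obtain ⟨S', _, _, _, y, hy, -, hdual⟩ := exists_dual_sequence.{u, u, v} (hf.comp hν)
    (ev := fun t : S => ContinuousMap.evalCLM ℝ t) (fun t v => v.norm_coe_le_norm t)
    (fun i => (f (ν i)).continuous) hε hcoord (D := Set.Icc (-1) 1)
    (B := {p | ‖vec (f ∘ ν) p.1‖ = 1 ∧ ∃ E : Finset ℕ, (∀ i ∈ E, δ ≤ |f (ν i) p.2|) ∧
      C₂ < |ContinuousMap.evalCLM ℝ p.2 (∑ i ∈ E, p.1 i • (f ∘ ν) i)|})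
    isClosed_Icc (by simp) (by simp) subset_rfl (fun p hp => hp.1)
    (fun p _ i hi => abs_le.1 hi)
    (fun n hn => by
      have := not_of_lt_iInf (lt_seq_of_lt_iInf hC₂ (hν.comp hn))
      push Not at this
      obtain ⟨t, E, hE, a, ha⟩ := this
      obtain ⟨r, a', E', -, -, hn', -, hsupp, hE', hlt⟩ := exists_normalized_extension hcoord
        hn (a := a) (E := E) (ψ := ContinuousMap.evalCLM ℝ t) (C := C₂)
        (by simpa [Function.comp_assoc] using ha)
      refine ⟨(a', t), ⟨hn', E', fun i hi => ?_, hlt⟩, fun i hi => ?_⟩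
      · obtain ⟨k, hk, rfl⟩ := hE' i hi
        exact hE k hk
      · obtain ⟨k, -, rfl⟩ := hsupp i hi
        exact ⟨k, rfl⟩)
  obtain ⟨m, hm, hlt⟩ := exists_lt_of_kPrime_lt hC₁ hy
  obtain ⟨C, hP, hCC⟩ := exists_lt_of_iInf_lt hlt
  have hC1 : 1 ≤ C := by
    have := hP (Finsupp.single 0 1) {0} (by simp [vec_single, hy.1]) (by simpa using hδ)
    simpa [vec_single, hy.1] using this
  -- Function values turn into coefficients without division by `1 + ε`, so δ itself is kept.
  obtain ⟨⟨a, t⟩, ⟨-, E, hE, hE2⟩, n, c, b, hb, -, -, hsum⟩ := hdual m hm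
  obtain ⟨E', hE', hs⟩ := hsum E
  have h1 := hP b E' hb fun k hk => by
    rw [(hE' k hk).2]
    exact hE _ (hE' k hk).1
  have h2 := ((∑ k ∈ E', b k • (y ∘ m) k).norm_coe_le_norm c).trans h1
  refine false_of_bounds hε hb hC1 (EReal.coe_lt_coe_iff.1 hCC) hCε hE2 hs ?_
  simpa using h2

theorem lStar_le_lPrime {δ : ℝ} (hδ : δ ≤ 1) : lStar.{u} δ ≤ lPrime.{v} δ := by
  refine iSup_le fun S => iSup_le fun _ => iSup_le fun _ => iSup_le fun _ => iSup_le fun f =>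
    iSup_le fun hf => iSup_le fun hfδ => ?_
  by_contra! h
  obtain ⟨C₁, hC₁, h⟩ := EReal.lt_iff_exists_real_btwn.1 h
  obtain ⟨C₂, hC, hC₂⟩ := EReal.lt_iff_exists_real_btwn.1 h
  obtain ⟨ε, hε, hCε, -⟩ := exists_pos_mul_one_add_lt (EReal.coe_lt_coe_iff.1 hC) zero_lt_one
  obtain ⟨ν, hν, hcoord⟩ := hf.exists_coord_le hε
  have := hf.nonempty
  obtain ⟨S', _, _, _, y, hy, -, hdual⟩ := exists_dual_sequence.{u, u, v} (hf.comp hν)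
    (ev := fun t : S => ContinuousMap.evalCLM ℝ t) (fun t v => v.norm_coe_le_norm t)
    (fun i => (f (ν i)).continuous) hε hcoord (D := Set.Icc (-1) 1)
    (B := {p | ‖vec (f ∘ ν) p.1‖ = 1 ∧ ∃ E : Finset ℕ,
      C₂ < |ContinuousMap.evalCLM ℝ p.2 (∑ i ∈ E, p.1 i • (f ∘ ν) i)|})
    isClosed_Icc (by simp) (by simp) subset_rfl (fun p hp => hp.1)
    (fun p _ i hi => abs_le.1 hi)
    (fun n hn => by
      have := not_of_lt_iInf (lt_seq_of_lt_iInf hC₂ (hν.comp hn))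
      push Not at this
      obtain ⟨a, E, ha⟩ := this
      obtain ⟨t, ht⟩ := exists_abs_apply_eq_norm (∑ i ∈ E, a i • (f ∘ ν ∘ n) i)
      rw [← ht] at ha
      obtain ⟨r, a', E', -, -, hn', -, hsupp, -, hlt⟩ := exists_normalized_extension hcoord
        hn (a := a) (E := E) (ψ := ContinuousMap.evalCLM ℝ t) (C := C₂) ha
      refine ⟨(a', t), ⟨hn', E', hlt⟩, fun i hi => ?_⟩
      obtain ⟨k, -, rfl⟩ := hsupp i hi
      exact ⟨k, rfl⟩)
  obtain ⟨m, hm, hlt⟩ := exists_lt_of_lPrime_lt hC₁ hy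
  obtain ⟨C, hP, hCC⟩ := exists_lt_of_iInf_lt hlt
  have hC1 : 1 ≤ C := by
    have := hP (Finsupp.single 0 1) {0} (by simp [vec_single, hy.1]) (fun i hi => by
      obtain rfl : i = 0 := by simpa using Finsupp.support_single_subset hi
      simpa using hδ)
    simpa [vec_single, hy.1] using this
  obtain ⟨⟨a, t⟩, ⟨-, E, hE⟩, n, c, b, hb, -, hbf, hsum⟩ := hdual m hm
  obtain ⟨E', hE', hs⟩ := hsum E
  have h1 := hP b E' hb fun k hk => by
    have hk := Finsupp.mem_support_iff.1 hk
    have hbk : b k = f (ν (n k)) t := (hbf k).resolve_left hk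
    rw [hbk] at hk ⊢
    exact ((hfδ (ν (n k)) t).resolve_left (by simpa using hk)).1
  have h2 := ((∑ k ∈ E', b k • (y ∘ m) k).norm_coe_le_norm c).trans h1
  refine false_of_bounds hε hb hC1 (EReal.coe_lt_coe_iff.1 hCC) hCε hE hs ?_
  simpa using h2

theorem DualBall.abs_toStrongDual_le {X : Type v} [NormedAddCommGroup X] [NormedSpace ℝ X]
    (t : DualBall X) (v : X) : |WeakDual.toStrongDual t.1 v| ≤ ‖v‖ :=
  t.abs_apply_le v

theorem kPrime_le_kStar {δ' δ : ℝ} (hlt : δ' < δ) (hδ : δ ≤ 1) : kPrime.{v} δ ≤ kStar.{u} δ' := by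
  refine iSup_le fun X => iSup_le fun _ => iSup_le fun _ => iSup_le fun _ => iSup_le fun x =>
    iSup_le fun hx => ?_
  by_contra! h
  obtain ⟨C₁, hC₁, h⟩ := EReal.lt_iff_exists_real_btwn.1 h
  obtain ⟨C₂, hC, hC₂⟩ := EReal.lt_iff_exists_real_btwn.1 h
  obtain ⟨ε, hε, hCε, hδε⟩ := exists_pos_mul_one_add_lt (EReal.coe_lt_coe_iff.1 hC) hlt
  obtain ⟨ν, hν, hcoord⟩ := hx.exists_coord_le hε
  obtain ⟨S', _, _, _, y, hy, -, hdual⟩ := exists_dual_sequence.{v, v, u} (hx.comp hν)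
    (ev := fun t : DualBall X => WeakDual.toStrongDual t.1) DualBall.abs_toStrongDual_le
    (fun i => DualBall.continuous_eval _) hε hcoord (D := Set.Icc (-1) 1)
    (B := {p | ‖vec (x ∘ ν) p.1‖ = 1 ∧ ∃ E : Finset ℕ, (∀ i ∈ E, δ ≤ |p.1 i|) ∧
      C₂ < |WeakDual.toStrongDual p.2.1 (∑ i ∈ E, p.1 i • (x ∘ ν) i)|})
    isClosed_Icc (by simp) (by simp) subset_rfl (fun p hp => hp.1)
    (fun p _ i hi => abs_le.1 hi)
    (fun n hn => by
      have := not_of_lt_iInf (lt_seq_of_lt_iInf hC₂ (hν.comp hn))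
      push Not at this
      obtain ⟨a, E, ha1, hE, ha⟩ := this
      obtain ⟨t, ht⟩ := DualBall.exists_apply_eq (∑ i ∈ E, a i • (x ∘ ν ∘ n) i)
      rw [← ht] at ha
      obtain ⟨r, a', E', hr, hr1, hn', hra, hsupp, hE', hlt⟩ := exists_normalized_extension hcoord
        hn (a := a) (E := E) (ψ := WeakDual.toStrongDual t.1) (C := C₂)
        (ha.trans_le (le_abs_self _))
      refine ⟨(a', t), ⟨hn', E', fun i hi => ?_, hlt⟩, fun i hi => ?_⟩
      · obtain ⟨k, hk, rfl⟩ := hE' i hi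
        exact (hE k hk).trans (abs_le_abs_of_eq_mul hr ha1 hr1 (hra k))
      · obtain ⟨k, -, rfl⟩ := hsupp i hi
        exact ⟨k, rfl⟩)
  obtain ⟨m, hm, hlt⟩ := exists_lt_of_kStar_lt hC₁ hy
  obtain ⟨C, hP, hCC⟩ := exists_lt_of_iInf_lt hlt
  have hC1 : 1 ≤ C := by
    have := hy.nonempty
    obtain ⟨t, ht⟩ := exists_abs_apply_eq_norm (y (m 0))
    rw [hy.1] at ht
    have := hP t {0} (by simp [ht]; linarith) (Finsupp.single 0 1)
    simpa [vec_single, hy.1, ht] using this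
  obtain ⟨⟨a, t⟩, ⟨-, E, hE, hE2⟩, n, c, b, hb, hyc, -, hsum⟩ := hdual m hm
  obtain ⟨E', hE', hs⟩ := hsum E
  -- Coefficients turn into function values divided by `1 + ε`. The gap between δ' and δ absorbs the
  -- division.
  have h1 := hP c E' (fun k hk => by
    have := hE _ (hE' k hk).1
    change δ' ≤ |y (m k) c|
    rw [hyc, abs_div, abs_of_pos (by positivity : 0 < 1 + ε), le_div_iff₀ (by positivity)]
    exact hδε.le.trans this) b
  exact false_of_bounds hε hb hC1 (EReal.coe_lt_coe_iff.1 hCC) hCε hE2 hs h1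

theorem lPrime_le_lStar {δ' δ : ℝ} (hlt : δ' < δ) (hδ : δ ≤ 1) : lPrime.{v} δ ≤ lStar.{u} δ' := by
  refine iSup_le fun X => iSup_le fun _ => iSup_le fun _ => iSup_le fun _ => iSup_le fun x =>
    iSup_le fun hx => ?_
  by_contra! h
  obtain ⟨C₁, hC₁, h⟩ := EReal.lt_iff_exists_real_btwn.1 h
  obtain ⟨C₂, hC, hC₂⟩ := EReal.lt_iff_exists_real_btwn.1 h
  obtain ⟨ε, hε, hCε, hδε⟩ := exists_pos_mul_one_add_lt (EReal.coe_lt_coe_iff.1 hC) hlt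
  obtain ⟨ν, hν, hcoord⟩ := hx.exists_coord_le hε
  obtain ⟨S', _, _, _, y, hy, hyD, hdual⟩ := exists_dual_sequence.{v, v, u} (hx.comp hν)
    (ev := fun t : DualBall X => WeakDual.toStrongDual t.1) DualBall.abs_toStrongDual_le
    (fun i => DualBall.continuous_eval _) hε hcoord
    -- Restricting all coordinates to this closed set gives the dual sequence the value gap required
    -- in L*.
    (D := {z : ℝ | |z| ∈ ({0} ∪ Set.Icc δ' 1 : Set ℝ)})
    (B := {p | ‖vec (x ∘ ν) p.1‖ = 1 ∧ (∀ i ∈ p.1.support, δ ≤ |p.1 i|) ∧ ∃ E : Finset ℕ,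
      C₂ < |WeakDual.toStrongDual p.2.1 (∑ i ∈ E, p.1 i • (x ∘ ν) i)|})
    ((isClosed_singleton.union isClosed_Icc).preimage continuous_abs) (by simp)
    (by simp; linarith)
    (fun z hz => abs_le.1 (hz.elim (fun h => h.le.trans zero_le_one) fun h => h.2))
    (fun p hp => hp.1)
    (fun p hp i hi => by
      by_cases h : p.1 i = 0
      · simp [h]
      · refine .inr ⟨?_, hi⟩
        rw [abs_div, abs_of_pos (by positivity : 0 < 1 + ε), le_div_iff₀ (by positivity)]
        exact hδε.le.trans (hp.2.1 i (Finsupp.mem_support_iff.2 h)))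
    (fun n hn => by
      have := not_of_lt_iInf (lt_seq_of_lt_iInf hC₂ (hν.comp hn))
      push Not at this
      obtain ⟨a, E, ha1, hE, ha⟩ := this
      obtain ⟨t, ht⟩ := DualBall.exists_apply_eq (∑ i ∈ E, a i • (x ∘ ν ∘ n) i)
      rw [← ht] at ha
      obtain ⟨r, a', E', hr, hr1, hn', hra, hsupp, -, hlt⟩ := exists_normalized_extension hcoord
        hn (a := a) (E := E) (ψ := WeakDual.toStrongDual t.1) (C := C₂)
        (ha.trans_le (le_abs_self _))
      refine ⟨(a', t), ⟨hn', fun i hi => ?_, E', hlt⟩, fun i hi => ?_⟩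
      · obtain ⟨k, hk, rfl⟩ := hsupp i hi
        exact (hE k hk).trans (abs_le_abs_of_eq_mul hr ha1 hr1 (hra k))
      · obtain ⟨k, -, rfl⟩ := hsupp i hi
        exact ⟨k, rfl⟩)
  obtain ⟨m, hm, hlt⟩ := exists_lt_of_lStar_lt hC₁ hy hyD
  obtain ⟨C, hP, hCC⟩ := exists_lt_of_iInf_lt hlt
  have hC1 : 1 ≤ C := by
    have := hP (Finsupp.single 0 1) {0}
    simpa [vec_single, hy.1] using this
  obtain ⟨⟨a, t⟩, ⟨-, -, E, hE⟩, n, c, b, hb, -, -, hsum⟩ := hdual m hm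
  obtain ⟨E', -, hs⟩ := hsum E
  have h2 := ((∑ k ∈ E', b k • (y ∘ m) k).norm_coe_le_norm c).trans (hP b E')
  refine false_of_bounds hε hb hC1 (EReal.coe_lt_coe_iff.1 hCC) hCε hE hs ?_
  simpa using h2

end Inequalities

end PartialUnc

end

/-- The spaces `S` in `kStar`, `lStar` and the Banach spaces in `kPrime`, `lPrime` may range over
two different universes. -/
theorem theorem7 (δ' δ : ℝ) (hδ' : 0 < δ') (hlt : δ' < δ) (hδ : δ ≤ 1) :
    (PartialUnc.kStar.{u} δ ≤ PartialUnc.kPrime.{v} δ ∧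
      PartialUnc.kPrime.{v} δ ≤ PartialUnc.kStar.{u} δ') ∧
    (PartialUnc.lStar.{u} δ ≤ PartialUnc.lPrime.{v} δ ∧
      PartialUnc.lPrime.{v} δ ≤ PartialUnc.lStar.{u} δ') :=
  ⟨⟨PartialUnc.kStar_le_kPrime hδ, PartialUnc.kPrime_le_kStar hlt hδ⟩,
    PartialUnc.lStar_le_lPrime hδ, PartialUnc.lPrime_le_lStar hlt hδ⟩
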